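/- Let $F$ be a field of characteristic different from $2$ (characteristic $0$ is allowed), let $L/F$ be a field extension of finite degree $m$, and let $n$ be an even integer with $m \ge n \ge 2$. Write $n = 2^{s+1} r$ with $s \ge 0$ and $r$ odd. A code $C \subset L^n$ is an $L$-linear subspace of $L^n$. It is self-dual if $C = C^\perp$, where $C^\perp = \{x \in L^n : \sum_{i=1}^n x_i c_i = 0 \text{ for all } c \in C\}$. Fix an $F$-basis $\alpha = (\alpha_1, \dots, \alpha_m)$ of $L$. For $c = (c_1, \dots, c_n) \in L^n$ let $M_\alpha(c) \in \mathrm{M}_{m \times n}(F)$ be the matrix whose $j$-th column consists of the coordinates of $c_j$ in the basis $\alpha$, and let $M_\alpha(C) = \{M_\alpha(c) : c \in C\}$. An $F$-linear subspace $\mathscr{C} \subset \mathrm{M}_{m\times n}(F)$ is MRD if its rank distance $d_1(\mathscr{C}) = \min_{M \in \mathscr{C} \setminus \{0\}} \mathrm{rk}(M)$ equals $n - \frac{\dim_F \mathscr{C}}{m} + 1$, and $C$ is MRD if $M_\alpha(C)$ is MRD (this does not depend on the choice of $\alpha$). 1. If $-1$ is a sum of $2^s$ squares in $F$, then there is no self-dual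 MRD code $C \subset L^n$. 2. If $m$ is odd, then there is no self-dual MRD code $C \subset L^n$. -/

import Mathlib

noncomputable section

namespace RankMetric

/-- The rank distance of a Delsarte rank metric code, that is, of an `F`-linear subspace of the
space of `m × n` matrices: the minimal rank of a nonzero codeword. (The zero code has no nonzero
codeword; it gets the value `0`.) -/
def rankDistance {F : Type*} [Field F] {m n : ℕ}
    (D : Submodule F (Matrix (Fin m) (Fin n) F)) : ℕ :=
  sInf {k : ℕ | ∃ M ∈ D, M ≠ 0 ∧ M.rank = k}

/-- A Delsarte rank metric code is MRD if it attains the Singleton bound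
`d₁(D) ≤ n - dim_F(D) / m + 1`. -/
def IsMRD {F : Type*} [Field F] {m n : ℕ}
    (D : Submodule F (Matrix (Fin m) (Fin n) F)) : Prop :=
  (rankDistance D : ℚ) = (n : ℚ) - (Module.finrank F D : ℚ) / (m : ℚ) + 1

variable {F L : Type*} [Field F] [Field L] [Algebra F L]

/-- The map sending `c = (c₁, …, cₙ) ∈ Lⁿ` to the `m × n` matrix over `F` whose `j`-th column
consists of the coordinates of `c_j` in the basis `α` of `L` over `F`. -/
def expand {m n : ℕ} (α : Module.Basis (Fin m) F L) :
    (Fin n → L) →ₗ[F] Matrix (Fin m) (Fin n) F where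
  toFun c := α.toMatrix c
  map_add' c c' := by
    ext i j
    simp [Module.Basis.toMatrix_apply]
  map_smul' a c := by
    ext i j
    simp [Module.Basis.toMatrix_apply]

/-- The Delsarte code attached to a Gabidulin code `C` (an `L`-linear subspace of `Lⁿ`) and a
basis of `L` over `F`. -/
def matrixCode {m n : ℕ} (α : Module.Basis (Fin m) F L) (C : Submodule L (Fin n → L)) :
    Submodule F (Matrix (Fin m) (Fin n) F) :=
  (C.restrictScalars F).map (expand α)

variable (F) in
/-- A Gabidulin code `C ⊆ Lⁿ` is MRD if the Delsarte code attached to it by a basis of `L` over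
`F` is MRD. Changing the basis multiplies all the matrices on the left by one invertible matrix,
so the choice of the basis does not matter (see `isMRD_matrixCode_iff`). -/
def IsGabidulinMRD {n : ℕ} (C : Submodule L (Fin n → L)) : Prop :=
  ∃ α : Module.Basis (Fin (Module.finrank F L)) F L, IsMRD (matrixCode α C)

theorem rank_expand_eq {m n : ℕ} (α β : Module.Basis (Fin m) F L) (c : Fin n → L) :
    (expand α c).rank = (expand β c).rank := by
  have key : ∀ α β : Module.Basis (Fin m) F L, (expand α c).rank ≤ (expand β c).rank := by
    intro α β
    have h : expand α c = α.toMatrix β * expand β c :=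
      (α.toMatrix_mul_toMatrix β c).symm
    rw [h]
    exact Matrix.rank_mul_le_right _ _
  exact le_antisymm (key α β) (key β α)

theorem expand_injective {m n : ℕ} (α : Module.Basis (Fin m) F L) :
    Function.Injective (expand (n := n) α) := by
  intro c c' h
  funext j
  apply α.repr.injective
  ext i
  exact congrFun (congrFun h i) j

theorem rankDistance_matrixCode {m n : ℕ} (α : Module.Basis (Fin m) F L)
    (C : Submodule L (Fin n → L)) :
    rankDistance (matrixCode α C) = sInf {k : ℕ | ∃ c ∈ C, c ≠ 0 ∧ (expand α c).rank = k} := by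
  unfold rankDistance
  congr 1
  ext k
  constructor
  · rintro ⟨_, ⟨c, hc, rfl⟩, h0, hk⟩
    refine ⟨c, hc, ?_, hk⟩
    rintro rfl
    exact h0 (map_zero _)
  · rintro ⟨c, hc, h0, hk⟩
    exact ⟨_, ⟨c, hc, rfl⟩, fun h => h0 (expand_injective α (h.trans (map_zero _).symm)), hk⟩

theorem isMRD_matrixCode_iff {m n : ℕ} (α β : Module.Basis (Fin m) F L)
    (C : Submodule L (Fin n → L)) : IsMRD (matrixCode α C) ↔ IsMRD (matrixCode β C) := by
  have h1 : ∀ γ : Module.Basis (Fin m) F L,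
      Module.finrank F (matrixCode γ C) = Module.finrank F (C.restrictScalars F) := fun γ =>
    (Submodule.equivMapOfInjective _ (expand_injective γ) _).finrank_eq.symm
  unfold IsMRD
  rw [h1 α, h1 β, rankDistance_matrixCode, rankDistance_matrixCode]
  simp only [rank_expand_eq α β]

/-- The dual code `C^⊥` for the standard inner product `(x, y) ↦ ∑ᵢ xᵢ yᵢ` of `Lⁿ`. -/
def dualCode {n : ℕ} (C : Submodule L (Fin n → L)) : Submodule L (Fin n → L) where
  carrier := {x | ∀ c ∈ C, x ⬝ᵥ c = 0}
  zero_mem' := by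
    intro c _
    exact zero_dotProduct c
  add_mem' := by
    intro x y hx hy c hc
    rw [add_dotProduct, hx c hc, hy c hc, add_zero]
  smul_mem' := by
    intro a x hx c hc
    rw [smul_dotProduct, hx c hc, smul_zero]

/-- A Gabidulin code is self-dual if it equals its dual code. -/
def IsSelfDual {n : ℕ} (C : Submodule L (Fin n → L)) : Prop :=
  C = dualCode C

end RankMetric

end

/-! A self-dual `C` has dimension `n / 2`, so being MRD forces every nonzero codeword to have rank
greater than `n / 2`. A codeword in the `L`-span of an `n / 2`-dimensional subspace of `Fⁿ` has rank
at most `n / 2` (`rank_expand_le`), so it suffices to find one.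

Such a codeword exists once `Fⁿ` itself contains a self-dual `W`
(`exists_mem_extendScalars_of_isSelfDual`). For a hyperplane `H` of `W`, the quotient `H^⊥ / H` is a
hyperbolic plane over `F`. Over `L` its only isotropic lines are still the two defined over `F`, and
these correspond to `W` and one further Lagrangian. By dimension `C` contains a nonzero vector of
the extension of `H^⊥`; it is isotropic, hence lies in the extension of one of the two.

It remains to produce `W`. If `-1` is a sum of `2 ^ s` squares, multiplicativity of the form `x₁² +
⋯ + x_N²` with `N = 2 ^ s` gives a matrix with `A * Aᵀ = -1`, and the graph of a block sum of copies
of `A` is self-dual. If `m` is odd, `C` makes the sum of `n` squares hyperbolic over `L`, and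
Springer's theorem brings this down to `F`. -/

namespace RankMetric

open Module

/-! ### Duality for the standard inner product. -/

section DualCode

variable {K : Type*} [Field K] {n : ℕ}

theorem mem_dualCode {C : Submodule K (Fin n → K)} {x : Fin n → K} :
    x ∈ dualCode C ↔ ∀ c ∈ C, x ⬝ᵥ c = 0 := Iff.rfl

theorem finrank_dualCode (C : Submodule K (Fin n → K)) :
    finrank K (dualCode C) + finrank K C = n := by
  let B : LinearMap.BilinForm K (Fin n → K) := dotProductBilin K K
  have hB : B.Nondegenerate := by
    have hr : B.IsRefl := fun x y h => by
      simpa [B, dotProduct_comm] using h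
    refine (LinearMap.IsRefl.nondegenerate_iff_separatingLeft hr).2 fun x hx => ?_
    exact dotProduct_eq_zero x fun w => hx w
  have h : dualCode C = B.orthogonal C := by
    ext x
    simp only [mem_dualCode, LinearMap.BilinForm.mem_orthogonal_iff,
      B, dotProductBilin_apply_apply]
    exact forall₂_congr fun c _ => by rw [dotProduct_comm]
  have h1 := LinearMap.BilinForm.finrank_orthogonal hB C
  have h2 := Submodule.finrank_le C
  rw [finrank_fin_fun] at h1 h2
  rw [h, h1]
  omega

theorem dualCode_anti {C D : Submodule K (Fin n → K)} (h : C ≤ D) : dualCode D ≤ dualCode C :=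
  fun _ hx c hc => hx c (h hc)

theorem le_dualCode_comm {C D : Submodule K (Fin n → K)} : C ≤ dualCode D ↔ D ≤ dualCode C := by
  constructor <;> intro h x hx c hc <;> rw [dotProduct_comm] <;> exact h hc x hx

theorem dualCode_sup (C D : Submodule K (Fin n → K)) :
    dualCode (C ⊔ D) = dualCode C ⊓ dualCode D := by
  refine le_antisymm (le_inf (dualCode_anti le_sup_left) (dualCode_anti le_sup_right)) ?_
  rw [le_dualCode_comm]
  exact sup_le (le_dualCode_comm.1 inf_le_left) (le_dualCode_comm.1 inf_le_right)

theorem span_singleton_le_dualCode_iff {u : Fin n → K} {D : Submodule K (Fin n → K)} :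
    D ≤ dualCode (K ∙ u) ↔ u ∈ dualCode D := by
  rw [le_dualCode_comm, Submodule.span_singleton_le_iff_mem]

end DualCode

/-! ### Extension of scalars from `Fⁿ` to `Lⁿ`, and its effect on rank. -/

section Extension

variable {F L : Type*} [Field F] [Field L] [Algebra F L] {n : ℕ}

variable (L) in
/-- The `L`-span in `Lⁿ` of a subspace of `Fⁿ`. -/
def extendScalars (W : Submodule F (Fin n → F)) : Submodule L (Fin n → L) :=
  Submodule.span L ((fun w : Fin n → F => algebraMap F L ∘ w) '' W)

theorem algebraMap_comp_dotProduct (v w : Fin n → F) :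
    (algebraMap F L ∘ v) ⬝ᵥ (algebraMap F L ∘ w) = algebraMap F L (v ⬝ᵥ w) := by
  simp [dotProduct]

theorem algebraMap_comp_mem_extendScalars {W : Submodule F (Fin n → F)} {w : Fin n → F}
    (hw : w ∈ W) : algebraMap F L ∘ w ∈ extendScalars L W :=
  Submodule.subset_span ⟨w, hw, rfl⟩

theorem extendScalars_le_iff {W : Submodule F (Fin n → F)} {D : Submodule L (Fin n → L)} :
    extendScalars L W ≤ D ↔ ∀ w ∈ W, algebraMap F L ∘ w ∈ D := by
  rw [extendScalars, Submodule.span_le, Set.image_subset_iff]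
  rfl

theorem extendScalars_mono {V W : Submodule F (Fin n → F)} (h : V ≤ W) :
    extendScalars L V ≤ extendScalars L W :=
  extendScalars_le_iff.2 fun _ hw => algebraMap_comp_mem_extendScalars (h hw)

theorem extendScalars_eq_span_range {ι : Type*} {W : Submodule F (Fin n → F)}
    {v : ι → Fin n → F} (hv : Submodule.span F (Set.range v) = W) :
    extendScalars L W = Submodule.span L (Set.range fun i => algebraMap F L ∘ v i) := by
  refine le_antisymm (extendScalars_le_iff.2 fun w hw => ?_) (Submodule.span_le.2 ?_)
  · rw [← hv] at hw
    induction hw using Submodule.span_induction with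
    | mem x hx =>
      obtain ⟨i, rfl⟩ := hx
      exact Submodule.subset_span ⟨i, rfl⟩
    | zero =>
      convert Submodule.zero_mem _
      ext; simp
    | add x y _ _ hx hy =>
      convert Submodule.add_mem _ hx hy
      ext; simp
    | smul a x _ hx =>
      convert Submodule.smul_mem _ (algebraMap F L a) hx
      ext; simp
  · rintro _ ⟨i, rfl⟩
    exact algebraMap_comp_mem_extendScalars (hv ▸ Submodule.subset_span ⟨i, rfl⟩)

theorem span_range_coe_basis {ι : Type*} {W : Submodule F (Fin n → F)} (b : Basis ι F W) :
    Submodule.span F (Set.range fun i => (b i : Fin n → F)) = W := by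
  have h := congrArg (Submodule.map W.subtype) b.span_eq
  rwa [Submodule.map_span, ← Set.range_comp, Submodule.map_top, Submodule.range_subtype] at h

theorem finrank_extendScalars (W : Submodule F (Fin n → F)) :
    finrank L (extendScalars L W) = finrank F W := by
  let b := finBasis F W
  have hli : LinearIndependent F fun i => (b i : Fin n → F) :=
    b.linearIndependent.map' W.subtype (Submodule.ker_subtype W)
  rw [extendScalars_eq_span_range (span_range_coe_basis b),
    finrank_span_eq_card (linearIndependent_algebraMap_comp_iff.2 hli), Fintype.card_fin]

theorem extendScalars_sup (V W : Submodule F (Fin n → F)) :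
    extendScalars L (V ⊔ W) = extendScalars L V ⊔ extendScalars L W := by
  refine le_antisymm (extendScalars_le_iff.2 fun x hx => ?_)
    (sup_le (extendScalars_mono le_sup_left) (extendScalars_mono le_sup_right))
  obtain ⟨v, hv, w, hw, rfl⟩ := Submodule.mem_sup.1 hx
  convert Submodule.add_mem_sup (algebraMap_comp_mem_extendScalars (L := L) hv)
    (algebraMap_comp_mem_extendScalars (L := L) hw)
  ext; simp

theorem extendScalars_span_singleton (u : Fin n → F) :
    extendScalars L (F ∙ u) = L ∙ (algebraMap F L ∘ u) := by
  rw [extendScalars_eq_span_range (v := fun _ : Unit => u) (by simp)]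
  simp

theorem extendScalars_dualCode (W : Submodule F (Fin n → F)) :
    extendScalars L (dualCode W) = dualCode (extendScalars L W) := by
  refine Submodule.eq_of_le_of_finrank_eq ?_ ?_
  · refine extendScalars_le_iff.2 fun x hx => ?_
    rw [← Submodule.span_singleton_le_iff_mem, le_dualCode_comm, extendScalars_le_iff]
    intro w hw
    rw [← Submodule.span_singleton_le_iff_mem, le_dualCode_comm,
      Submodule.span_singleton_le_iff_mem, mem_dualCode]
    intro c hc
    obtain ⟨a, rfl⟩ := Submodule.mem_span_singleton.1 hc
    rw [dotProduct_smul, algebraMap_comp_dotProduct, hx w hw, map_zero, smul_zero]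
  · have h1 := finrank_dualCode (extendScalars L W)
    have h2 := finrank_dualCode W
    rw [finrank_extendScalars] at h1 ⊢
    omega

/-- Taking the `i`-th coordinate of `c = ∑ j, y j • v j`, with all `v j` in `W`, gives an
`F`-combination of the `v j`; so every row of the matrix lies in `W`. -/
theorem rank_expand_le {m : ℕ} (α : Basis (Fin m) F L) {W : Submodule F (Fin n → F)}
    {c : Fin n → L} (hc : c ∈ extendScalars L W) : (expand α c).rank ≤ finrank F W := by
  rw [Matrix.rank_eq_finrank_span_row]
  refine Submodule.finrank_mono (Submodule.span_le.2 ?_)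
  rintro _ ⟨i, rfl⟩
  rw [extendScalars_eq_span_range (span_range_coe_basis (finBasis F W))] at hc
  obtain ⟨y, rfl⟩ := (Submodule.mem_span_range_iff_exists_fun L).1 hc
  have h : (expand α (∑ j, y j • (algebraMap F L ∘ (finBasis F W j : Fin n → F)))).row i =
      ∑ j, α.repr (y j) i • (finBasis F W j : Fin n → F) := by
    ext l
    change α.repr ((∑ j, y j • (algebraMap F L ∘ (finBasis F W j : Fin n → F))) l) i = _
    simp only [Finset.sum_apply, Pi.smul_apply, Function.comp_apply, map_sum,
      Finsupp.coe_finsetSum, smul_eq_mul]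
    refine Finset.sum_congr rfl fun j _ => ?_
    rw [mul_comm, ← Algebra.smul_def, map_smul, Finsupp.smul_apply, smul_eq_mul, mul_comm]
  rw [SetLike.mem_coe, h]
  exact Submodule.sum_mem _ fun j _ => Submodule.smul_mem _ _ (Subtype.prop _)

end Extension

end RankMetric

namespace RankMetric

open Module

/-! ### A rational Lagrangian forces a codeword of low rank. -/

section Lagrangian

theorem finrank_sup_span_singleton_le {K V : Type*} [Field K] [AddCommGroup V] [Module K V]
    [FiniteDimensional K V] (H : Submodule K V) (u : V) :
    finrank K (H ⊔ K ∙ u : Submodule K V) ≤ finrank K H + 1 :=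
  (Submodule.finrank_add_le_finrank_add_finrank H (K ∙ u)).trans <|
    Nat.add_le_add_left ((finrank_span_le_card ({u} : Set V)).trans (by simp)) _

variable {F L : Type*} [Field F] [Field L] [Algebra F L] {n : ℕ}

/-- If `Fⁿ` contains a self-dual code, then every self-dual code in `Lⁿ` meets the extension of an
`n / 2`-dimensional subspace of `Fⁿ`: a hyperplane of the rational self-dual code lies in exactly
two Lagrangians, and the extension of one of them meets the given code. -/
theorem exists_mem_extendScalars_of_isSelfDual (h2 : (2 : F) ≠ 0) (hn : n ≠ 0)
    {C : Submodule L (Fin n → L)} (hC : IsSelfDual C) {W : Submodule F (Fin n → F)}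
    (hW : IsSelfDual W) :
    ∃ V : Submodule F (Fin n → F), 2 * finrank F V = n ∧ ∃ c ∈ C, c ≠ 0 ∧
      c ∈ extendScalars L V := by
  have hdW := finrank_dualCode W
  rw [← show W = dualCode W from hW] at hdW
  have hdC := finrank_dualCode C
  rw [← show C = dualCode C from hC] at hdC
  have hWpos : 0 < finrank F W := by omega
  let b := finBasis F W
  let i₀ : Fin (finrank F W) := ⟨0, hWpos⟩
  let e : Fin n → F := b i₀
  let H : Submodule F (Fin n → F) :=
    Submodule.span F ((fun i => (b i : Fin n → F)) '' {i₀}ᶜ)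
  have hWH : W = H ⊔ F ∙ e := by
    rw [← span_range_coe_basis b, ← Set.image_univ, ← Set.compl_union_self {i₀}, Set.image_union,
      Submodule.span_union, Set.image_singleton]
  have hHW : H ≤ W := hWH ▸ le_sup_left
  have heW : e ∈ W := (b i₀).2
  have hli : LinearIndependent F fun i => (b i : Fin n → F) :=
    b.linearIndependent.map' W.subtype (Submodule.ker_subtype W)
  have hdH : finrank F H < finrank F W := by
    refine Submodule.finrank_lt_finrank_of_lt (lt_of_le_of_ne hHW fun h => ?_)
    exact hli.notMem_span_image (s := {i₀}ᶜ) (x := i₀) (by simp) (by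
      change e ∈ H
      rw [h]; exact heW)
  have hdH' : finrank F W ≤ finrank F H + 1 := by
    conv_lhs => rw [hWH]
    exact finrank_sup_span_singleton_le H e
  have hdHd := finrank_dualCode H
  obtain ⟨g, hgH, hgW⟩ : ∃ g ∈ dualCode H, g ∉ W := by
    by_contra! h
    have := Submodule.finrank_mono (show dualCode H ≤ W from h)
    omega
  have hge : g ⬝ᵥ e ≠ 0 := fun h => hgW <| by
    have hge' : g ∈ dualCode (F ∙ e) := by
      intro c hc
      obtain ⟨a, rfl⟩ := Submodule.mem_span_singleton.1 hc
      rw [dotProduct_smul, h, smul_zero]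
    rw [show W = dualCode W from hW, hWH, dualCode_sup]
    exact ⟨hgH, hge'⟩
  have hee : e ⬝ᵥ e = 0 := by
    have h := heW
    rw [show W = dualCode W from hW] at h
    exact h e heW
  have heH : e ∈ dualCode H := by
    have h := heW
    rw [show W = dualCode W from hW] at h
    exact dualCode_anti hHW h
  -- The multiple `t` of `e` solves `g ⬝ᵥ g - 2 * t * (g ⬝ᵥ e) = 0`. Thus `e` and `u` are isotropic
  -- and span the hyperbolic plane `H^⊥ / H`.
  let u : Fin n → F := g - (g ⬝ᵥ g / (2 * (g ⬝ᵥ e))) • e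
  have huH : u ∈ dualCode H := Submodule.sub_mem _ hgH (Submodule.smul_mem _ _ heH)
  have hue : u ⬝ᵥ e = g ⬝ᵥ e := by simp [u, hee]
  have huu : u ⬝ᵥ u = 0 := by
    simp only [u, sub_dotProduct, dotProduct_sub, smul_dotProduct, dotProduct_smul, hee,
      dotProduct_comm e g, smul_eq_mul]
    field_simp
    ring
  have huW : u ∉ W := fun h => hge <| by
    rw [← hue]
    rw [show W = dualCode W from hW] at h
    exact h e heW
  have hsup : W ⊔ F ∙ u = dualCode H := by
    refine Submodule.eq_of_le_of_finrank_le (sup_le ?_ ?_) ?_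
    · exact hWH ▸ sup_le (hHW.trans (hW.le.trans (dualCode_anti hHW)))
        ((Submodule.span_singleton_le_iff_mem _ _).2 heH)
    · exact (Submodule.span_singleton_le_iff_mem _ _).2 huH
    · have : finrank F W < finrank F (W ⊔ F ∙ u : Submodule F (Fin n → F)) := by
        refine Submodule.finrank_lt_finrank_of_lt (lt_of_le_of_ne le_sup_left fun h => huW ?_)
        rw [h]
        exact Submodule.mem_sup_right (Submodule.mem_span_singleton_self u)
      omega
  have huH' : u ∉ H := fun h => huW (hHW h)
  have hdV : finrank F (H ⊔ F ∙ u : Submodule F (Fin n → F)) = finrank F W := by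
    have h1 : finrank F H < finrank F (H ⊔ F ∙ u : Submodule F (Fin n → F)) := by
      refine Submodule.finrank_lt_finrank_of_lt (lt_of_le_of_ne le_sup_left fun h => huH' ?_)
      rw [h]
      exact Submodule.mem_sup_right (Submodule.mem_span_singleton_self u)
    have h3 := finrank_sup_span_singleton_le H u
    omega
  -- The dimensions `n / 2` and `n / 2 + 1` add up to more than `n`.
  obtain ⟨c, hcC, hcH, hc0⟩ : ∃ c ∈ C, c ∈ extendScalars L (dualCode H) ∧ c ≠ 0 := by
    have h1 := Submodule.finrank_sup_add_finrank_inf_eq C (extendScalars L (dualCode H))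
    have h3 := Submodule.finrank_le (C ⊔ extendScalars L (dualCode H))
    rw [finrank_extendScalars] at h1
    rw [finrank_fin_fun] at h3
    have h4 : C ⊓ extendScalars L (dualCode H) ≠ ⊥ := fun h => by
      rw [h, finrank_bot] at h1
      omega
    obtain ⟨c, hc, hc0⟩ := Submodule.exists_mem_ne_zero_of_ne_bot h4
    exact ⟨c, hc.1, hc.2, hc0⟩
  have hcc : c ⬝ᵥ c = 0 := by
    have h := hcC
    rw [show C = dualCode C from hC] at h
    exact h c hcC
  have hcd := hcH
  rw [extendScalars_dualCode] at hcd
  have huL : algebraMap F L ∘ u ∈ dualCode (extendScalars L H) := by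
    rw [← extendScalars_dualCode]
    exact algebraMap_comp_mem_extendScalars huH
  have heL : algebraMap F L ∘ e ∈ dualCode (extendScalars L H) := by
    rw [← extendScalars_dualCode]
    exact algebraMap_comp_mem_extendScalars heH
  rw [← hsup, hWH, extendScalars_sup, extendScalars_sup, extendScalars_span_singleton,
    extendScalars_span_singleton] at hcH
  obtain ⟨w, hw, v, hv, hwv⟩ := Submodule.mem_sup.1 hcH
  obtain ⟨h, hh, w', hw', rfl⟩ := Submodule.mem_sup.1 hw
  obtain ⟨x, rfl⟩ := Submodule.mem_span_singleton.1 hw'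
  obtain ⟨y, rfl⟩ := Submodule.mem_span_singleton.1 hv
  set e' := algebraMap F L ∘ e with he'
  set u' := algebraMap F L ∘ u with hu'
  -- With `c = h + x • e' + y • u'` and `h` orthogonal to everything in sight, `0 = c ⬝ᵥ c = 2 * x *
  -- y * (u' ⬝ᵥ e')`.
  have hxy : x * y = 0 := by
    have h1 : c ⬝ᵥ h = 0 := hcd h hh
    have h3 : e' ⬝ᵥ h = 0 := heL h hh
    have h4 : u' ⬝ᵥ h = 0 := huL h hh
    have h5 : e' ⬝ᵥ e' = 0 := by rw [algebraMap_comp_dotProduct, hee, map_zero]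
    have h6 : u' ⬝ᵥ u' = 0 := by rw [algebraMap_comp_dotProduct, huu, map_zero]
    have h7 : u' ⬝ᵥ e' ≠ 0 := by
      rw [algebraMap_comp_dotProduct, hue]
      exact (map_ne_zero _).2 hge
    have h8 : (2 : L) ≠ 0 := by
      rw [← map_ofNat (algebraMap F L) 2]
      exact (map_ne_zero _).2 h2
    have h9 : c ⬝ᵥ c = 2 * (x * y * (u' ⬝ᵥ e')) := by
      have : c ⬝ᵥ c = c ⬝ᵥ (x • e' + y • u') := by
        rw [← zero_add (c ⬝ᵥ (x • e' + y • u')), ← h1, ← dotProduct_add, ← add_assoc, hwv]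
      rw [this, ← hwv]
      simp only [add_dotProduct, dotProduct_add, smul_dotProduct, dotProduct_smul, h5, h6,
        dotProduct_comm h, h3, h4, dotProduct_comm e' u', smul_eq_mul]
      ring
    rw [hcc] at h9
    have := (mul_eq_zero.1 h9.symm).resolve_left h8
    exact (mul_eq_zero.1 this).resolve_right h7
  rcases mul_eq_zero.1 hxy with rfl | rfl
  · refine ⟨H ⊔ F ∙ u, by omega, c, hcC, hc0, ?_⟩
    rw [extendScalars_sup, extendScalars_span_singleton, ← hwv, zero_smul, add_zero]
    exact Submodule.add_mem_sup hh hv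
  · refine ⟨W, by omega, c, hcC, hc0, ?_⟩
    rw [hWH, extendScalars_sup, extendScalars_span_singleton, ← hwv, zero_smul, add_zero]
    exact hw

/-- Since `dim_F C = m * dim_L C`, equality in the Singleton bound reads `d₁ = n - dim_L C + 1`; the
`+ 1` makes the inequality strict. -/
theorem IsGabidulinMRD.lt_rank_expand [FiniteDimensional F L] {C : Submodule L (Fin n → L)}
    (hC : IsGabidulinMRD F C) :
    ∃ α : Basis (Fin (finrank F L)) F L, ∀ c ∈ C, c ≠ 0 →
      n < finrank L C + (expand α c).rank := by
  obtain ⟨α, hα⟩ := hC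
  refine ⟨α, fun c hc hc0 => ?_⟩
  have h1 : finrank F (matrixCode α C) = finrank F L * finrank L C := by
    rw [finrank_mul_finrank F L C]
    exact (Submodule.equivMapOfInjective _ (expand_injective α) _).finrank_eq.symm
  have hm : (finrank F L : ℚ) ≠ 0 := Nat.cast_ne_zero.2 finrank_pos.ne'
  have h2 : rankDistance (matrixCode α C) ≤ (expand α c).rank := by
    rw [rankDistance_matrixCode]
    exact Nat.sInf_le ⟨c, hc, hc0, rfl⟩
  unfold IsMRD at hα
  rw [h1, Nat.cast_mul, mul_div_cancel_left₀ _ hm] at hα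
  have h3 : ((rankDistance (matrixCode α C) : ℕ) : ℚ) ≤ (expand α c).rank := Nat.cast_le.2 h2
  have h4 : (n : ℚ) < (finrank L C + (expand α c).rank : ℕ) := by
    push_cast
    linarith
  exact_mod_cast h4

theorem not_isGabidulinMRD_of_isSelfDual [FiniteDimensional F L] (h2 : (2 : F) ≠ 0) (hn : n ≠ 0)
    {C : Submodule L (Fin n → L)} (hC : IsSelfDual C) {W : Submodule F (Fin n → F)}
    (hW : IsSelfDual W) : ¬ IsGabidulinMRD F C := by
  intro hM
  obtain ⟨V, hV, c, hcC, hc0, hcV⟩ := exists_mem_extendScalars_of_isSelfDual h2 hn hC hW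
  obtain ⟨α, hα⟩ := hM.lt_rank_expand
  have h1 := hα c hcC hc0
  have h3 := rank_expand_le α hcV
  have h4 := finrank_dualCode C
  rw [← show C = dualCode C from hC] at h4
  omega

end Lagrangian

end RankMetric

namespace RankMetric

open Module Matrix
open scoped Kronecker

/-! ### Sums of `2 ^ s` squares and the hyperbolic form they give. -/

section SumOfSquares

variable {F : Type*} [Field F]

/-- A nonzero sum of `2 ^ s` squares is the multiplier of a similitude of the form
`x₁² + ⋯ + x_N²` with `N = 2 ^ s`. -/
theorem exists_matrix_mul_transpose_eq_smul_one (s : ℕ) (x : Fin (2 ^ s) → F)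
    (hx : ∑ i, x i ^ 2 ≠ 0) :
    ∃ A : Matrix (Fin (2 ^ s)) (Fin (2 ^ s)) F,
      A * Aᵀ = (∑ i, x i ^ 2) • (1 : Matrix (Fin (2 ^ s)) (Fin (2 ^ s)) F) := by
  induction s with
  | zero =>
    refine ⟨x 0 • 1, ?_⟩
    have : ∑ i : Fin (2 ^ 0), x i ^ 2 = x 0 ^ 2 := by simp
    rw [this]
    simp [smul_smul, sq]
  | succ s ih =>
    have hpow : 2 ^ s + 2 ^ s = 2 ^ (s + 1) := by rw [pow_succ]; ring
    let φ : Fin (2 ^ s) ⊕ Fin (2 ^ s) ≃ Fin (2 ^ (s + 1)) :=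
      finSumFinEquiv.trans (finCongr hpow)
    have hsum : ∑ i, x i ^ 2 =
        ∑ i, x (φ (.inl i)) ^ 2 + ∑ i, x (φ (.inr i)) ^ 2 := by
      rw [← φ.sum_comp, Fintype.sum_sum_type]
    suffices h : ∃ A : Matrix (Fin (2 ^ s) ⊕ Fin (2 ^ s)) (Fin (2 ^ s) ⊕ Fin (2 ^ s)) F,
        A * Aᵀ = (∑ i, x i ^ 2) • 1 by
      obtain ⟨A, hA⟩ := h
      refine ⟨A.submatrix φ.symm φ.symm, ?_⟩
      rw [transpose_submatrix, submatrix_mul_equiv, hA]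
      ext i j
      simp [one_apply]
    rw [hsum] at hx ⊢
    have iha := ih fun i => x (φ (.inl i))
    have ihb := ih fun i => x (φ (.inr i))
    set a := ∑ i, x (φ (.inl i)) ^ 2
    set b := ∑ i, x (φ (.inr i)) ^ 2
    -- The induction hypothesis needs a nonzero half-sum. If one half-sum vanishes, the other
    -- already is the multiplier and a block diagonal matrix suffices.
    by_cases ha : a = 0
    · rw [ha, zero_add] at hx ⊢
      obtain ⟨Z, hZ⟩ := ihb hx
      refine ⟨fromBlocks Z 0 0 Z, ?_⟩
      rw [fromBlocks_transpose, fromBlocks_multiply, ← fromBlocks_one, fromBlocks_smul]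
      simp [hZ]
    by_cases hb : b = 0
    · rw [hb, add_zero]
      obtain ⟨Y, hY⟩ := iha ha
      refine ⟨fromBlocks Y 0 0 Y, ?_⟩
      rw [fromBlocks_transpose, fromBlocks_multiply, ← fromBlocks_one, fromBlocks_smul]
      simp [hY]
    obtain ⟨Y, hY⟩ := iha ha
    obtain ⟨Z, hZ⟩ := ihb hb
    have comm_of : ∀ {t : F} (_ : t ≠ 0) {X : Matrix (Fin (2 ^ s)) (Fin (2 ^ s)) F},
        X * Xᵀ = t • 1 → Xᵀ * X = t • 1 := by
      intro t ht X hX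
      have h1 : X * (t⁻¹ • Xᵀ) = 1 := by
        rw [Matrix.mul_smul, hX, smul_smul, inv_mul_cancel₀ ht, one_smul]
      have h3 := mul_eq_one_comm.1 h1
      rw [Matrix.smul_mul] at h3
      rw [← h3, smul_smul, mul_inv_cancel₀ ht, one_smul]
    have hY' := comm_of ha hY
    have hZ' := comm_of hb hZ
    have k1 : Y * (Yᵀ * Z * Yᵀ) = a • (Z * Yᵀ) := by
      rw [← Matrix.mul_assoc, ← Matrix.mul_assoc, hY, Matrix.smul_mul, Matrix.smul_mul,
        Matrix.one_mul]
    have k2 : Y * Zᵀ * Y * (Yᵀ * Z * Yᵀ) = (a * b * a) • 1 := by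
      rw [Matrix.mul_assoc, k1, Matrix.mul_smul, Matrix.mul_assoc Y, ← Matrix.mul_assoc Zᵀ, hZ',
        Matrix.smul_mul, Matrix.one_mul, Matrix.mul_smul, hY, smul_smul, smul_smul, mul_assoc]
    -- The lower left block is forced by orthogonality of the two block rows, with `Y` kept at lower
    -- right; its own norm is `a⁻² * (a * b * a) = b`.
    refine ⟨fromBlocks Y Z (-a⁻¹ • (Y * Zᵀ * Y)) Y, ?_⟩
    have ht : (-a⁻¹ • (Y * Zᵀ * Y))ᵀ = -a⁻¹ • (Yᵀ * Z * Yᵀ) := by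
      rw [transpose_smul, transpose_mul, transpose_mul, transpose_transpose, Matrix.mul_assoc]
    rw [fromBlocks_transpose, fromBlocks_multiply, ← fromBlocks_one, fromBlocks_smul, ht]
    congr 1
    · rw [hY, hZ, add_smul]
    · rw [Matrix.mul_smul, k1, smul_smul, neg_mul, inv_mul_cancel₀ ha]
      simp
    · rw [Matrix.smul_mul, Matrix.mul_assoc, hY, Matrix.mul_smul, Matrix.mul_one, smul_smul,
        neg_mul, inv_mul_cancel₀ ha]
      simp
    · rw [Matrix.smul_mul, Matrix.mul_smul, k2, hY, smul_smul, smul_smul, ← add_smul]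
      congr 1
      field_simp
      ring

theorem isSelfDual_of_le_of_finrank {n : ℕ} {W : Submodule F (Fin n → F)}
    (h : W ≤ dualCode W) (hd : n ≤ 2 * finrank F W) : IsSelfDual W := by
  refine Submodule.eq_of_le_of_finrank_le h ?_
  have := finrank_dualCode W
  omega

/-- If `-1` is a sum of `2 ^ s` squares, then the sum of `2 ^ (s + 1) * r` squares is a hyperbolic
quadratic form. -/
theorem exists_isSelfDual_of_sum_sq_eq_neg_one {n s r : ℕ} (hn : n = 2 ^ (s + 1) * r)
    {x : Fin (2 ^ s) → F} (hx : -1 = ∑ i, x i ^ 2) :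
    ∃ W : Submodule F (Fin n → F), IsSelfDual W := by
  obtain ⟨A, hA⟩ := exists_matrix_mul_transpose_eq_smul_one s x (by rw [← hx]; simp)
  rw [← hx] at hA
  let ι := Fin (2 ^ s) × Fin r
  let B : Matrix ι ι F := A ⊗ₖ 1
  have hB : B * Bᵀ = -1 := by
    have : Bᵀ = Aᵀ ⊗ₖ 1 := by
      have h := kroneckerMap_transpose (· * ·) A (1 : Matrix (Fin r) (Fin r) F)
      rw [transpose_one] at h
      exact h.symm
    rw [this, ← mul_kronecker_mul, hA, Matrix.one_mul, smul_kronecker, one_kronecker_one]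
    simp
  have hcard : Fintype.card (ι ⊕ ι) = n := by
    simp [ι, hn, pow_succ]; ring
  let φ : Fin n ≃ ι ⊕ ι := (Fintype.equivFinOfCardEq hcard).symm
  -- The graph of `v ↦ v ᵥ* B` is totally isotropic because `B * Bᵀ = -1` cancels the two halves of
  -- the inner product.
  let f : (ι → F) →ₗ[F] (Fin n → F) :=
    { toFun := fun v => Sum.elim v (v ᵥ* B) ∘ φ
      map_add' := fun v w => by
        ext i; simp only [Function.comp_apply, Pi.add_apply]
        rcases φ i with j | j <;> simp [add_vecMul]
      map_smul' := fun a v => by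
        ext i; simp only [Function.comp_apply, Pi.smul_apply]
        rcases φ i with j | j <;> simp [smul_vecMul] }
  have hf : Function.Injective f := fun v w h => by
    ext j
    simpa [f] using congrFun h (φ.symm (.inl j))
  refine ⟨LinearMap.range f, isSelfDual_of_le_of_finrank ?_ ?_⟩
  · rintro _ ⟨v, rfl⟩ _ ⟨w, rfl⟩
    change (Sum.elim v (v ᵥ* B) ∘ φ) ⬝ᵥ (Sum.elim w (w ᵥ* B) ∘ φ) = 0
    rw [comp_equiv_dotProduct_comp_equiv, sumElim_dotProduct_sumElim, ← mulVec_transpose B w,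
      ← dotProduct_mulVec, mulVec_mulVec, hB]
    simp [neg_mulVec]
  · rw [LinearMap.finrank_range_of_inj hf, finrank_fintype_fun_eq_card, ← hcard,
      Fintype.card_sum]
    omega

end SumOfSquares

end RankMetric

namespace RankMetric

open Module Polynomial IntermediateField

/-! ### Springer's theorem on odd degree extensions. -/

section Springer

variable {ι : Type*} [Fintype ι]

/-- The value at `x` of the quadratic form with coefficient matrix `B`. -/
def evalForm {K A : Type*} [Field K] [CommRing A] [Algebra K A] (B : Matrix ι ι K) (x : ι → A) : A :=
  ∑ i, ∑ j, B i j • (x i * x j)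

theorem map_evalForm {K A A' : Type*} [Field K] [CommRing A] [Algebra K A] [CommRing A']
    [Algebra K A'] (φ : A →ₐ[K] A') (B : Matrix ι ι K) (x : ι → A) :
    φ (evalForm B x) = evalForm B fun i => φ (x i) := by
  simp [evalForm]

theorem evalForm_mul_left {K A : Type*} [Field K] [CommRing A] [Algebra K A] (B : Matrix ι ι K)
    (a : A) (x : ι → A) : evalForm B (fun i => a * x i) = a * a * evalForm B x := by
  simp only [evalForm, Finset.mul_sum]
  refine Finset.sum_congr rfl fun i _ => Finset.sum_congr rfl fun j _ => ?_
  rw [mul_smul_comm, mul_mul_mul_comm]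

theorem evalForm_map {F K A : Type*} [Field F] [Field K] [CommRing A] [Algebra F K] [Algebra K A]
    [Algebra F A] [IsScalarTower F K A] (B : Matrix ι ι F) (x : ι → A) :
    evalForm (B.map (algebraMap F K)) x = evalForm B x := by
  simp [evalForm]

variable {K : Type*} [Field K] {B : Matrix ι ι K}

/-- Anisotropy prevents leading terms from cancelling: if `N` is the maximal degree, the coefficient
of degree `2N` is the form at the nonzero vector of degree `N` coefficients. So the value has even
degree. -/
theorem exists_natDegree_evalForm (hB : ∀ y : ι → K, evalForm B y = 0 → y = 0)
    {x : ι → K[X]} (hx : x ≠ 0) :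
    ∃ i, x i ≠ 0 ∧ evalForm B x ≠ 0 ∧
      (evalForm B x).natDegree = (x i).natDegree + (x i).natDegree := by
  classical
  obtain ⟨i₀, hi₀⟩ := Function.ne_iff.1 hx
  obtain ⟨i, hi, hmax⟩ := Finset.exists_max_image (Finset.univ.filter fun i => x i ≠ 0)
    (fun i => (x i).natDegree) ⟨i₀, by simpa using hi₀⟩
  simp only [Finset.mem_filter, Finset.mem_univ, true_and] at hi hmax
  have hle : ∀ j, (x j).natDegree ≤ (x i).natDegree := fun j => by
    by_cases hj : x j = 0
    · simp [hj]
    · exact hmax j hj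
  set N := (x i).natDegree with hN
  have hcoeff : (evalForm B x).coeff (N + N) = evalForm B fun j => (x j).coeff N := by
    simp only [evalForm, finsetSum_coeff, coeff_smul]
    refine Finset.sum_congr rfl fun j _ => Finset.sum_congr rfl fun k _ => ?_
    rw [coeff_mul_add_eq_of_natDegree_le (hle j) (hle k)]
  have hne : (evalForm B x).coeff (N + N) ≠ 0 := fun h => by
    rw [hcoeff] at h
    have := congrFun (hB _ h) i
    exact hi (leadingCoeff_eq_zero.1 this)
  have hdeg : (evalForm B x).natDegree ≤ N + N :=
    natDegree_sum_le_of_forall_le _ _ fun j _ => natDegree_sum_le_of_forall_le _ _ fun k _ =>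
      (natDegree_smul_le _ _).trans (natDegree_mul_le_of_le (hle j) (hle k))
  exact ⟨i, hi, fun h => hne (by rw [h, coeff_zero]),
    le_antisymm hdeg (le_natDegree_of_ne_zero hne)⟩

/-- Descent on the degree of `f`: values of the form have even degree, so an odd degree divisor
leaves a cofactor of odd degree, which is smaller once `x` is reduced modulo `f`. -/
theorem exists_irreducible_dvd_of_dvd_evalForm (hB : ∀ y : ι → K, evalForm B y = 0 → y = 0)
    {f : K[X]} (hf : Odd f.natDegree) {x : ι → K[X]} (hfx : f ∣ evalForm B x) :
    ∃ p, Irreducible p ∧ p ∣ f ∧ ∀ i, p ∣ x i := by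
  classical
  induction hd : f.natDegree using Nat.strong_induction_on generalizing f x with
  | _ d ih =>
    subst hd
    have hf0 : f ≠ 0 := by
      rintro rfl
      simp at hf
    have hfu : ¬ IsUnit f := fun h => by
      rw [natDegree_eq_zero_of_isUnit h] at hf
      simp at hf
    by_cases hirr : Irreducible f
    · by_contra! hcon
      obtain ⟨i₀, hi₀⟩ := hcon f hirr dvd_rfl
      let x' : ι → K[X] := fun i => x i % f
      have hmk : ∀ i, AdjoinRoot.mkₐ f (x' i) = AdjoinRoot.mkₐ f (x i) := fun i =>
        AdjoinRoot.mk_eq_mk.2 (by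
          rw [← dvd_neg, neg_sub]
          exact ⟨x i / f, sub_eq_of_eq_add' (EuclideanDomain.mod_add_div _ _).symm⟩)
      have hfx' : f ∣ evalForm B x' := by
        rw [← AdjoinRoot.mk_eq_zero] at hfx ⊢
        have h1 := map_evalForm (AdjoinRoot.mkₐ f) B x
        have h2 := map_evalForm (AdjoinRoot.mkₐ f) B x'
        simp only [hmk] at h2
        exact (h2.trans h1.symm).trans hfx
      have hx'd : ∀ i, (x' i).natDegree < f.natDegree := fun i =>
        natDegree_mod_lt _ hf.pos.ne'
      have hx'0 : x' i₀ ≠ 0 := fun h => hi₀ (EuclideanDomain.mod_eq_zero.1 h)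
      obtain ⟨inst⟩ : Nonempty (NormalizedGCDMonoid K[X]) := inferInstance
      -- Dividing by the gcd makes `z` primitive; `f` does not divide the gcd, for degree reasons,
      -- so it still divides the value at `z`.
      obtain ⟨z, hz, hgcd⟩ := Finset.extract_gcd x' (s := Finset.univ) ⟨i₀, Finset.mem_univ _⟩
      set g := Finset.univ.gcd x'
      have hxz : x' = fun i => g * z i := funext fun i => hz i (Finset.mem_univ i)
      have hg : ¬ f ∣ g := fun h => by
        have h1 : f ∣ x' i₀ := h.trans ⟨z i₀, congrFun hxz i₀⟩
        exact absurd (natDegree_le_of_dvd h1 hx'0) (not_le.2 (hx'd i₀))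
      have hg0 : g ≠ 0 := fun h => hg (h ▸ dvd_zero f)
      have hfz : f ∣ evalForm B z := by
        rw [hxz, evalForm_mul_left] at hfx'
        have hp := hirr.prime
        exact (hp.dvd_or_dvd hfx').resolve_left fun h => (hp.dvd_or_dvd h).elim hg hg
      have hz0 : z ≠ 0 := fun h => hx'0 (by rw [hxz, h]; simp)
      obtain ⟨i, hzi, hq0, hqd⟩ := exists_natDegree_evalForm hB hz0
      obtain ⟨h, hh⟩ := hfz
      have hh0 : h ≠ 0 := fun h0 => hq0 (by rw [hh, h0, mul_zero])
      have hzd : (z i).natDegree < f.natDegree := by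
        have h1 := hx'd i
        rw [hxz] at h1
        simp only [natDegree_mul hg0 hzi] at h1
        omega
      rw [hh, natDegree_mul hf0 hh0] at hqd
      -- Here `deg f + deg h = 2 * deg (z i)` and `deg (z i) < deg f`, so `deg h` is odd and smaller
      -- than `deg f`. Descent then gives a common factor of the primitive `z`.
      have hhodd : Odd h.natDegree := by
        rw [Nat.odd_iff] at hf ⊢
        omega
      obtain ⟨p, hp, -, hpz⟩ := ih h.natDegree (by omega) hhodd (x := z)
        (hh ▸ dvd_mul_left h f) rfl
      exact hp.not_isUnit (isUnit_of_dvd_one (hgcd ▸ Finset.dvd_gcd fun i _ => hpz i))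
    · rw [irreducible_iff] at hirr
      push Not at hirr
      obtain ⟨a, b, hab, ha, hb⟩ := hirr hfu
      have ha0 : a ≠ 0 := fun h => hf0 (by rw [hab, h, zero_mul])
      have hb0 : b ≠ 0 := fun h => hf0 (by rw [hab, h, mul_zero])
      have hda : 0 < a.natDegree := natDegree_pos_iff_degree_pos.2 (degree_pos_of_ne_zero_of_nonunit ha0 ha)
      have hdb : 0 < b.natDegree := natDegree_pos_iff_degree_pos.2 (degree_pos_of_ne_zero_of_nonunit hb0 hb)
      have hdf : f.natDegree = a.natDegree + b.natDegree := by rw [hab, natDegree_mul ha0 hb0]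
      have haf : a ∣ f := ⟨b, hab⟩
      have hbf : b ∣ f := ⟨a, by rw [hab, mul_comm]⟩
      rcases Nat.even_or_odd a.natDegree with hea | hoa
      · have hob : Odd b.natDegree := by
          rw [Nat.odd_iff] at hf ⊢
          rw [Nat.even_iff] at hea
          omega
        obtain ⟨p, hp, hpb, hpx⟩ := ih b.natDegree (by omega) hob (hbf.trans hfx) rfl
        exact ⟨p, hp, hpb.trans hbf, hpx⟩
      · obtain ⟨p, hp, hpa, hpx⟩ := ih a.natDegree (by omega) hoa (haf.trans hfx) rfl
        exact ⟨p, hp, hpa.trans haf, hpx⟩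

/-- Springer's theorem: an anisotropic quadratic form stays anisotropic over an extension of odd
degree. -/
theorem evalForm_eq_zero_of_odd_finrank {F L : Type*} [Field F] [Field L] [Algebra F L]
    [FiniteDimensional F L] (hodd : Odd (finrank F L)) {B : Matrix ι ι F}
    (hB : ∀ y : ι → F, evalForm B y = 0 → y = 0) {x : ι → L} (hx : evalForm B x = 0) : x = 0 := by
  -- This form allows induction along simple extensions, each of odd degree by the tower law.
  suffices h : ∀ E : IntermediateField F L, ∀ x : ι → L, (∀ i, x i ∈ E) → evalForm B x = 0 → x = 0
    from h ⊤ x (fun _ => mem_top) hx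
  intro E
  induction E using induction_on_adjoin with
  | base =>
    intro x hx h
    choose y hy using fun i => mem_bot.1 (hx i)
    obtain rfl : (fun i => Algebra.ofId F L (y i)) = x := funext hy
    rw [← map_evalForm] at h
    have := hB y ((map_eq_zero _).1 h)
    subst this
    ext; simp
  | ih E θ ih =>
    intro x hx h
    have hEB : ∀ y : ι → E, evalForm (B.map (algebraMap F E)) y = 0 → y = 0 := fun y hy => by
      rw [evalForm_map] at hy
      have h1 := map_evalForm E.val B y
      rw [hy, map_zero] at h1
      have h2 := ih _ (fun i => (y i).2) h1.symm
      ext i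
      exact congrFun h2 i
    have hint : IsIntegral E θ := IsIntegral.of_finite E θ
    have hdeg : Odd (minpoly E θ).natDegree := by
      rw [← adjoin.finrank hint]
      have h1 : finrank E E⟮θ⟯ ∣ finrank F L :=
        (Dvd.intro _ (finrank_mul_finrank E E⟮θ⟯ L)).trans
          (Dvd.intro_left _ (finrank_mul_finrank F E L))
      exact hodd.of_dvd_nat h1
    have hpoly : ∀ i, ∃ p : E[X], aeval θ p = x i := fun i => by
      have h1 : x i ∈ E⟮θ⟯.toSubalgebra := hx i
      rw [adjoin_simple_toSubalgebra_of_isAlgebraic hint.isAlgebraic,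
        Algebra.adjoin_singleton_eq_range_aeval] at h1
      exact h1
    choose p hp using hpoly
    have hdvd : minpoly E θ ∣ evalForm (B.map (algebraMap F E)) p := by
      rw [minpoly.dvd_iff, map_evalForm, evalForm_map]
      simpa only [hp] using h
    obtain ⟨q, hq, hqm, hqp⟩ := exists_irreducible_dvd_of_dvd_evalForm hEB hdeg hdvd
    have hmq : minpoly E θ ∣ q := (hq.associated_of_dvd (minpoly.irreducible hint) hqm).symm.dvd
    ext i
    rw [← hp i]
    exact (minpoly.dvd_iff).1 (hmq.trans (hqp i))

end Springer

/-! ### Descent of hyperbolicity along odd degree extensions. -/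

section OddDegree

variable {F L : Type*} [Field F] [Field L] [Algebra F L] {n : ℕ}

theorem sum_smul_dotProduct_sum_smul {ι : Type*} [Fintype ι] (v : ι → Fin n → F) (y : ι → L) :
    (∑ i, y i • (algebraMap F L ∘ v i)) ⬝ᵥ (∑ i, y i • (algebraMap F L ∘ v i)) =
      evalForm (Matrix.of fun i j => v i ⬝ᵥ v j) y := by
  simp only [evalForm, sum_dotProduct, dotProduct_sum, smul_dotProduct, dotProduct_smul,
    algebraMap_comp_dotProduct, smul_eq_mul, Matrix.of_apply]
  simp only [Finset.mul_sum]
  rw [Finset.sum_comm]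
  refine Finset.sum_congr rfl fun i _ => Finset.sum_congr rfl fun j _ => ?_
  rw [Algebra.smul_def]
  ring

/-- If the sum of `n` squares becomes hyperbolic over an extension of odd degree, then it is
hyperbolic. -/
theorem exists_isSelfDual_of_odd_finrank [FiniteDimensional F L] (hodd : Odd (finrank F L))
    {C : Submodule L (Fin n → L)} (hC : IsSelfDual C) :
    ∃ W : Submodule F (Fin n → F), IsSelfDual W := by
  -- A maximal totally isotropic `W` has `W^⊥ / W` anisotropic; below, `D ⊓ dualCode W` represents
  -- this quotient.
  obtain ⟨W, hW, hmax⟩ := (wellFounded_gt (α := Submodule F (Fin n → F))).has_min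
    {W | W ≤ dualCode W} ⟨⊥, show ⊥ ≤ dualCode ⊥ from bot_le⟩
  simp only [Set.mem_ofPred_eq] at hW hmax
  refine ⟨W, isSelfDual_of_le_of_finrank hW ?_⟩
  have hmem : ∀ v ∈ dualCode W, v ⬝ᵥ v = 0 → v ∈ W := fun v hv hvv => by
    by_contra hvW
    refine hmax (W ⊔ F ∙ v) ?_ (lt_of_le_of_ne le_sup_left fun h => hvW ?_)
    · have hv' : v ∈ dualCode (F ∙ v) := fun c hc => by
        obtain ⟨a, rfl⟩ := Submodule.mem_span_singleton.1 hc
        rw [dotProduct_smul, hvv, smul_zero]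
      rw [dualCode_sup]
      refine sup_le (le_inf hW ?_) ?_
      · rwa [span_singleton_le_dualCode_iff]
      · rw [Submodule.span_singleton_le_iff_mem]
        exact ⟨hv, hv'⟩
    · rw [h]
      exact Submodule.mem_sup_right (Submodule.mem_span_singleton_self v)
  obtain ⟨D, hD⟩ := Submodule.exists_isCompl W
  have hsup : W ⊔ (D ⊓ dualCode W) = dualCode W := by
    rw [← sup_inf_assoc_of_le D hW, hD.sup_eq_top, top_inf_eq]
  let b := finBasis F (D ⊓ dualCode W : Submodule F (Fin n → F))
  let v : Fin (finrank F (D ⊓ dualCode W : Submodule F (Fin n → F))) → Fin n → F :=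
    fun i => (b i : Fin n → F)
  have haniso : ∀ y : _ → F, evalForm (Matrix.of fun i j => v i ⬝ᵥ v j) y = 0 → y = 0 := fun y hy => by
    rw [← sum_smul_dotProduct_sum_smul, Algebra.algebraMap_self, RingHom.coe_id] at hy
    simp only [Function.id_comp] at hy
    have hvy : ∑ i, y i • v i = ((∑ i, y i • b i : (D ⊓ dualCode W : Submodule F (Fin n → F))) :
        Fin n → F) := by
      simp [v]
    rw [hvy] at hy
    set d := ∑ i, y i • b i
    have h0 : (d : Fin n → F) = 0 := (Submodule.mem_bot F).1 <| hD.disjoint.le_bot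
      ⟨hmem d d.2.2 hy, d.2.1⟩
    have h1 : ∑ i, y i • b i = 0 := Subtype.ext h0
    exact funext (Fintype.linearIndependent_iff.1 b.linearIndependent y h1)
  -- By Springer's theorem the complement of `W` in `W^⊥` stays anisotropic over `L`, so an
  -- isotropic vector has no component there.
  have hCW : C ⊓ extendScalars L (dualCode W) ≤ extendScalars L W := by
    rintro c ⟨hcC, hcW⟩
    have hcd := hcW
    rw [SetLike.mem_coe, extendScalars_dualCode] at hcd
    rw [SetLike.mem_coe, ← hsup, extendScalars_sup] at hcW
    obtain ⟨w, hw, u, hu, rfl⟩ := Submodule.mem_sup.1 hcW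
    rw [extendScalars_eq_span_range (span_range_coe_basis b)] at hu
    obtain ⟨y, hy⟩ := (Submodule.mem_span_range_iff_exists_fun L).1 hu
    have hwd : w ∈ dualCode (extendScalars L W) := by
      rw [← extendScalars_dualCode]
      exact extendScalars_mono hW hw
    have hcc : (w + u) ⬝ᵥ (w + u) = 0 := by
      have h := hcC
      rw [SetLike.mem_coe, show C = dualCode C from hC] at h
      exact h _ hcC
    have huu : u ⬝ᵥ u = 0 := by
      have h1 := hcd w hw
      have h2 := hwd w hw
      rw [add_dotProduct, h2, zero_add] at h1
      rwa [add_dotProduct, dotProduct_add, dotProduct_add, h2, h1, dotProduct_comm w u, h1,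
        zero_add, zero_add, zero_add] at hcc
    have hy0 : y = 0 := by
      refine evalForm_eq_zero_of_odd_finrank hodd haniso ?_
      rw [← sum_smul_dotProduct_sum_smul, ← huu, ← hy]
    rw [← hy, hy0]
    simpa using hw
  -- The left side is the dual of the sum of `C` and the extension of `W`. With `k` the dimension of
  -- their intersection, `n - (n / 2 + dim W - k) ≤ k`, so `n / 2 ≤ dim W`.
  have hinf : C ⊓ extendScalars L (dualCode W) ≤ C ⊓ extendScalars L W := le_inf inf_le_left hCW
  have h1 := Submodule.finrank_mono hinf
  have h2 := Submodule.finrank_sup_add_finrank_inf_eq C (extendScalars L W)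
  have h3 := finrank_dualCode (C ⊔ extendScalars L W)
  rw [dualCode_sup, ← extendScalars_dualCode, ← show C = dualCode C from hC] at h3
  have h4 := finrank_dualCode C
  rw [← show C = dualCode C from hC] at h4
  rw [finrank_extendScalars] at h2
  omega

end OddDegree

end RankMetric

theorem mainTheorem4 {F L : Type*} [Field F] [Field L] [Algebra F L] [FiniteDimensional F L]
    (hF : ringChar F ≠ 2) (m n s r : ℕ) (hm : Module.finrank F L = m) (hnm : n ≤ m)
    (hr : Odd r) (hn : n = 2 ^ (s + 1) * r) :
    ((∃ x : Fin (2 ^ s) → F, (-1 : F) = ∑ i, x i ^ 2) →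
      ¬ ∃ C : Submodule L (Fin n → L), RankMetric.IsSelfDual C ∧ RankMetric.IsGabidulinMRD F C) ∧
    (Odd m →
      ¬ ∃ C : Submodule L (Fin n → L), RankMetric.IsSelfDual C ∧ RankMetric.IsGabidulinMRD F C) := by
  have h2 : (2 : F) ≠ 0 := Ring.two_ne_zero hF
  have hn0 : n ≠ 0 := hn ▸ mul_ne_zero (pow_ne_zero _ two_ne_zero) hr.pos.ne'
  refine ⟨?_, ?_⟩
  · rintro ⟨x, hx⟩ ⟨C, hC, hM⟩
    obtain ⟨W, hW⟩ := RankMetric.exists_isSelfDual_of_sum_sq_eq_neg_one hn hx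
    exact RankMetric.not_isGabidulinMRD_of_isSelfDual h2 hn0 hC hW hM
  · rintro hodd ⟨C, hC, hM⟩
    obtain ⟨W, hW⟩ := RankMetric.exists_isSelfDual_of_odd_finrank (hm ▸ hodd) hC
    exact RankMetric.not_isGabidulinMRD_of_isSelfDual h2 hn0 hC hW hM
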